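/- Let $p \neq r$ be primes, let $k$ be an algebraically closed field of characteristic $r$, and let $G$ be a finite group with a split $BN$-pair $(B,N)$ of characteristic $p$ (for example, a finite group of Lie type in characteristic $p$): $G=\langle B,N\rangle$; $T=B\cap N$ is normal in $N$; $W=N/T$ is generated by a set $S$ of involutions such that $n_sBn_s\neq B$ and $n_sBn\subseteq Bn_snB\cup BnB$ for all $s \in S$, all representatives $n_s \in N$ of $s$ and all $n\in N$; $B=U\rtimes T$, where $U$ is the largest normal $p$-subgroup of $B$; $\bigcap_{n\in N}nBn^{-1}=T$; and $T$ is abelian. All modules are finite-dimensional left modules. For a one-dimensional $kT$-module $X$, let $R_T^G(X)=\mathrm{Ind}_B^G(\tilde X)$, where $\tilde X$ is the inflation of $X$ along $B\to B/U\cong T$. The principal series $\mathrm{Irr}_k(G|(T,X))$ consists of the irreducible $kG$-modules $Y$ such that $T$ is minimal among the Levi subgroups $L$ (the $N$-conjugates of the standard Levi subgroups $L_J$, $J\subseteq S$) with ${}^*R^G_L(Y)\neq 0$ and $X$ is a composition factor of the $kT$-module ${}^*R_T^G(Y)=Y^U$; here ${}^*R^G_L(Y)$ is the space of fixed points on $Y$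 of the largest normal $p$-subgroup of a parabolic subgroup with Levi complement $L$. Let $Y \in \mathrm{Irr}_k(G|(T,X))$, and let $Z$ be an irreducible $kG$-module with $Z\notin \mathrm{Irr}_k(G|(T,X))$. Then $\mathrm{Ext}^1_{kG}(R_T^G(X),Z)=0$; there is a (necessarily maximal) submodule $\mathscr L^0$ of $R_T^G(X)$ with $R_T^G(X)/\mathscr L^0\cong Y$; and for every such $\mathscr L^0$ the space $\mathrm{Ext}^1_{kG}(Y,Z)$ is finite-dimensional with $$\dim_k \mathrm{Ext}^1_{kG}(Y,Z)=[\mathrm{head}(\mathscr L^0):Z],$$ the multiplicity of $Z$ as a composition factor of $\mathrm{head}(\mathscr L^0)$, the quotient of $\mathscr L^0$ by the intersection of its maximal submodules. -/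

import Mathlib

open scoped MonoidAlgebra

universe u v

noncomputable section

/-! ### Split BN-pairs -/

/-- `O_p(P)`, the largest normal `p`-subgroup of `P` (`P` finite), as a join of all of them. -/
def pCore (p : ℕ) (P : Type v) [Group P] : Subgroup P :=
  sSup {K : Subgroup P | K.Normal ∧ IsPGroup p K}

instance pCore_normal (p : ℕ) (P : Type v) [Group P] : (pCore p P).Normal := by
  refine ⟨fun n hn g => ?_⟩
  have key : pCore p P ≤ (pCore p P).comap (MulAut.conj g).toMonoidHom :=
    sSup_le fun K hK x hx => (le_sSup hK : K ≤ pCore p P) (hK.1.conj_mem x hx g)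
  exact key hn

/-- The conjugate `g H g⁻¹`. -/
def conjSubgroup {G : Type v} [Group G] (g : G) (H : Subgroup G) : Subgroup G :=
  H.map (MulAut.conj g).toMonoidHom

/-- A split `BN`-pair of characteristic `p` on a group `G`, with torus `T = B ∩ N`, Weyl group
`W = N / T`, and set `S ⊆ W` of distinguished generators. -/
structure SplitBNPair (p : ℕ) (G : Type v) [Group G] where
  /-- the Borel subgroup -/
  B : Subgroup G
  /-- the subgroup covering the Weyl group -/
  N : Subgroup G
  /-- `G` is generated by `B` and `N` -/
  sup_eq_top : B ⊔ N = ⊤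
  /-- `T = B ∩ N` is normal in `N` -/
  [torus_normal : ((B ⊓ N).subgroupOf N).Normal]
  /-- the distinguished generators of the Weyl group -/
  S : Set (N ⧸ (B ⊓ N).subgroupOf N)
  /-- `W` is generated by `S` -/
  closure_S : Subgroup.closure S = ⊤
  /-- the elements of `S` are involutions (`s ≠ 1` follows from `conj_ne`) -/
  sq_eq_one : ∀ s ∈ S, s * s = 1
  /-- `n_s B n_s ≠ B` for every representative `n_s` of every `s ∈ S` -/
  conj_ne : ∀ n : N, (n : N ⧸ (B ⊓ N).subgroupOf N) ∈ S →
    (fun b : G => (n : G) * b * n) '' (B : Set G) ≠ B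
  /-- `n_s B n ⊆ B n_s n B ∪ B n B` for every representative `n_s` of every `s ∈ S` and `n ∈ N` -/
  mul_subset : ∀ m n : N, (m : N ⧸ (B ⊓ N).subgroupOf N) ∈ S → ∀ b ∈ B,
    (m : G) * b * n ∈
      DoubleCoset.doubleCoset ((m : G) * n) (B : Set G) B ∪
        DoubleCoset.doubleCoset (n : G) (B : Set G) B
  /-- `B = U ⋊ T` with `U = O_p(B)` (in particular the order of `T` is prime to `p`) -/
  split : Subgroup.IsComplement' ((B ⊓ N).subgroupOf B) (pCore p B)
  /-- `⋂_{n ∈ N} n B n⁻¹ = T` -/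
  iInf_conj : ⨅ n : N, conjSubgroup (n : G) B = B ⊓ N
  /-- `T` is abelian -/
  torus_comm : ∀ s ∈ B ⊓ N, ∀ t ∈ B ⊓ N, s * t = t * s

namespace SplitBNPair

variable {p : ℕ} {G : Type v} [Group G] (D : SplitBNPair p G)

/-- The torus `T = B ∩ N`. -/
def T : Subgroup G := D.B ⊓ D.N

lemma T_le_B : D.T ≤ D.B := inf_le_left

/-- The Weyl group `W = N / T`. -/
abbrev W : Type v := D.N ⧸ (D.B ⊓ D.N).subgroupOf D.N

/-- The subgroup generated by `C` and all representatives in `N` of the elements of `J ⊆ W`. -/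
def genOver (C : Subgroup G) (J : Set D.W) : Subgroup G :=
  C ⊔ Subgroup.closure {g : G | ∃ n : D.N, (n : D.W) ∈ J ∧ (n : G) = g}

/-- `n₀ ∈ N` represents the longest element of `W`, that is, `n₀ B n₀⁻¹` is the Borel subgroup
opposite to `B`. -/
def IsOpposite (n₀ : G) : Prop :=
  n₀ ∈ D.N ∧ D.B ⊓ conjSubgroup n₀ D.B = D.T

/-- The standard parabolic subgroup `P_J = ⟨B, n_s (s ∈ J)⟩`. -/
def parabolic (J : Set D.W) : Subgroup G := D.genOver D.B J

/-- The standard Levi subgroup `L_J` of `P_J`: the intersection of `P_J` with the opposite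
parabolic subgroup `⟨n₀ B n₀⁻¹, n_s (s ∈ J)⟩`. -/
def levi (n₀ : G) (J : Set D.W) : Subgroup G :=
  D.parabolic J ⊓ D.genOver (conjSubgroup n₀ D.B) J

/-- The pairs `(P, L) = (ⁿP_J, ⁿL_J)` with `J ⊆ S` and `n ∈ N`. -/
def IsLeviPair (P L : Subgroup G) : Prop :=
  ∃ J ⊆ D.S, ∃ n₀, D.IsOpposite n₀ ∧ ∃ n ∈ D.N,
    P = conjSubgroup n (D.parabolic J) ∧ L = conjSubgroup n (D.levi n₀ J)

end SplitBNPair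

/-! ### Harish-Chandra induction and restriction -/

section HarishChandra

variable {G : Type v} [Group G] {k : Type u} [Field k]

/-- The projection `P → L` with kernel `O_p(P)`, if `P = O_p(P) ⋊ L`. -/
def leviProj (p : ℕ) (P L : Subgroup G) (hL : L ≤ P)
    (h : Subgroup.IsComplement' (L.subgroupOf P) (pCore p P)) : P →* L :=
  ((Subgroup.subgroupOfEquivOfLe hL).toMonoidHom.comp h.QuotientMulEquiv.toMonoidHom).comp
    (QuotientGroup.mk' (pCore p P))

/-- Harish-Chandra induction `R_{L ⊆ P}^G(X)`: inflate `X` from `L` to `P = O_p(P) ⋊ L`, then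
induce to `G`. -/
def hcInd (p : ℕ) (P L : Subgroup G) (hL : L ≤ P)
    (h : Subgroup.IsComplement' (L.subgroupOf P) (pCore p P))
    {V : Type*} [AddCommGroup V] [Module k V] (X : Representation k L V) :
    Representation k G
      (Representation.IndV P.subtype (X.comp (leviProj p P L hL h))) :=
  Representation.ind P.subtype (X.comp (leviProj p P L hL h))

/-- The subspace `Y^{O_p(P)}`. -/
abbrev hcFixed (p : ℕ) (P : Subgroup G) {V : Type*} [AddCommGroup V] [Module k V]
    (Y : Representation k G V) : Submodule k V :=
  Representation.invariants ((Y.comp P.subtype).comp (pCore p P).subtype)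

/-- Harish-Chandra restriction `*R_{L ⊆ P}^G(Y)`: the space `Y^{O_p(P)}` with the action of `L`. -/
def hcRes (p : ℕ) (P L : Subgroup G) (hL : L ≤ P) {V : Type*} [AddCommGroup V] [Module k V]
    (Y : Representation k G V) : Representation k L (hcFixed p P Y) :=
  (Representation.toInvariants (Y.comp P.subtype) (pCore p P)).comp (Subgroup.inclusion hL)

end HarishChandra

/-! ### Composition factors and heads -/

section Modules

variable (A : Type*) [Ring A] (M : Type*) [AddCommGroup M] [Module A M]
  (Z : Type*) [AddCommGroup Z] [Module A Z]

/-- The simple module `Z` is a composition factor of `M`: it is isomorphic to `M₂ / M₁` for some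
submodules `M₁ ≤ M₂` of `M`. -/
def IsCompositionFactor : Prop :=
  IsSimpleModule A Z ∧ ∃ M₁ M₂ : Submodule A M, M₁ ≤ M₂ ∧
    Nonempty ((M₂ ⧸ M₁.submoduleOf M₂) ≃ₗ[A] Z)

/-- `[M : Z]`, the number of factors isomorphic to `Z` in a composition series
`0 = M₀ ⋖ M₁ ⋖ ⋯ ⋖ Mₗ = M` of a module `M` of finite length (and `0` if there is no such
series). -/
def compositionMultiplicity : ℕ :=
  open Classical in
  if h : ∃ s : CompositionSeries (Submodule A M), s.head = ⊥ ∧ s.last = ⊤ then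
    Nat.card {i : Fin h.choose.length //
      Nonempty ((h.choose i.succ ⧸
        (h.choose i.castSucc).submoduleOf (h.choose i.succ)) ≃ₗ[A] Z)}
  else 0

/-- The head of `M`: its quotient by the intersection of all maximal submodules. -/
abbrev ModuleHead : Type _ := M ⧸ Module.jacobson A M

end Modules

/-! ### Harish-Chandra series -/

namespace SplitBNPair

variable {p : ℕ} {G : Type v} [Group G] (D : SplitBNPair p G) {k : Type u} [Field k]

/-- `Y ∈ Irr_k(G | (L, X))`, where `L` is a Levi complement in `P`: `Y` is irreducible, `L` is
minimal among the Levi subgroups of `G` with `*R_L^G(Y) ≠ 0`, and `X` is a composition factor of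
`*R_L^G(Y)`. -/
def InSeries (P L : Subgroup G) (hL : L ≤ P)
    {VX : Type*} [AddCommGroup VX] [Module k VX] (X : Representation k L VX)
    {VY : Type*} [AddCommGroup VY] [Module k VY] (Y : Representation k G VY) : Prop :=
  Y.IsIrreducible ∧ hcFixed p P Y ≠ ⊥ ∧
    (∀ P' L' : Subgroup G, D.IsLeviPair P' L' → L' < L → hcFixed p P' Y = ⊥) ∧
    IsCompositionFactor k[L] (hcRes p P L hL Y).asModule X.asModule

/-- `Y` belongs to the principal series `Irr_k(G | (T, X))`. -/
def InPrincipalSeries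
    {VX : Type*} [AddCommGroup VX] [Module k VX] (X : Representation k D.T VX)
    {VY : Type*} [AddCommGroup VY] [Module k VY] (Y : Representation k G VY) : Prop :=
  D.InSeries D.B D.T D.T_le_B X Y

/-- The Harish-Chandra induced module `R_T^G(X) = Ind_B^G(X̃)`, as a `kG`-module. -/
abbrev R {VX : Type*} [AddCommGroup VX] [Module k VX] (X : Representation k D.T VX) : Type _ :=
  (hcInd p D.B D.T D.T_le_B D.split X).asModule

end SplitBNPair

/-- `Ext¹_{kG}(M, M')`, a vector space over `k`. -/
abbrev ExtOne (k : Type u) [Field k] (G : Type v) [Group G] (M M' : Type (max u v))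
    [AddCommGroup M] [Module k[G] M] [AddCommGroup M'] [Module k[G] M'] : Type (max u v) :=
  CategoryTheory.Abelian.Ext (ModuleCat.of k[G] M) (ModuleCat.of k[G] M') 1

end

/-! Harish-Chandra induction is left adjoint to `Y ↦ Y^{O_p(P)}`, and the latter is exact because
`|O_p(P)|` is invertible in `k`. If `X` is not a composition factor of `*R(Z)`, then, `kL` being
commutative Artinian, some element of `kL` kills `*R(Z)` and acts as the identity on `X`;
multiplication by it lifts the unit `X → *R(R(X))` along `*R(E) → *R(R(X))` for each extension `E`
of `R(X)` by `Z`, so by adjunction `E` splits and `Ext¹(R(X), Z) = 0`. Likewise `Hom(R(X), Z) = 0`.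
The long exact sequence of `0 → L⁰ → R(X) → Y → 0` therefore gives
`Ext¹(Y, Z) ≅ Hom(L⁰, Z) ≅ Hom(head(L⁰), Z)`, whose dimension is `[head(L⁰) : Z] · dim End(Z)` as
the head is semisimple. -/

universe w

noncomputable section

open Representation

section Commutative

lemma isCompositionFactor_of_injective {A M X : Type*} [Ring A] [AddCommGroup M] [Module A M]
    [AddCommGroup X] [Module A X] [IsSimpleModule A X] {f : X →ₗ[A] M}
    (hf : Function.Injective f) : IsCompositionFactor A M X :=
  ⟨‹_›, ⊥, LinearMap.range f, bot_le,
    ⟨Submodule.quotEquivOfEqBot _ (by simp [Submodule.submoduleOf]) ≪≫ₗ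
      (LinearEquiv.ofInjective f hf).symm⟩⟩

lemma IsCompositionFactor.nontrivial {A M X : Type*} [Ring A] [AddCommGroup M] [Module A M]
    [AddCommGroup X] [Module A X] (h : IsCompositionFactor A M X) : Nontrivial M := by
  obtain ⟨_, M₁, M₂, -, ⟨e⟩⟩ := h
  have : Nontrivial X := IsSimpleModule.nontrivial A X
  have : Nontrivial M₂ := (e.surjective.comp (M₁.submoduleOf M₂).mkQ_surjective).nontrivial
  exact M₂.subtype_injective.nontrivial

variable {A : Type*} [CommRing A] {M X : Type*} [AddCommGroup M] [Module A M]
  [AddCommGroup X] [Module A X]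

lemma IsCompositionFactor.annihilator_le (h : IsCompositionFactor A M X) :
    Module.annihilator A M ≤ Module.annihilator A X := by
  obtain ⟨-, M₁, M₂, -, ⟨e⟩⟩ := h
  exact (LinearMap.annihilator_le_of_injective M₂.subtype M₂.subtype_injective).trans <|
    LinearMap.annihilator_le_of_surjective (e.toLinearMap ∘ₗ (M₁.submoduleOf M₂).mkQ)
      (e.surjective.comp (Submodule.mkQ_surjective _))

lemma exists_lift_of_smul_eq_zero {K N : Type*} [AddCommGroup K] [Module A K] [AddCommGroup N]
    [Module A N] {i : K →ₗ[A] M} {g : M →ₗ[A] N} (hig : Function.Exact i g)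
    (hg : Function.Surjective g) {a : A} (haK : ∀ z : K, a • z = 0) (haX : ∀ x : X, a • x = x)
    (f : X →ₗ[A] N) : ∃ t : X →ₗ[A] M, g ∘ₗ t = f := by
  have ha : LinearMap.ker g ≤ LinearMap.ker (LinearMap.lsmul A M a) := fun m hm => by
    obtain ⟨z, rfl⟩ := (hig m).mp hm
    rw [LinearMap.mem_ker, LinearMap.lsmul_apply, ← map_smul, haK, map_zero]
  let l : N →ₗ[A] M := (LinearMap.ker g).liftQ (LinearMap.lsmul A M a) ha ∘ₗ
    (g.quotKerEquivOfSurjective hg).symm.toLinearMap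
  have hl (m : M) : l (g m) = a • m :=
    congrArg ((LinearMap.ker g).liftQ (LinearMap.lsmul A M a) ha)
      ((g.quotKerEquivOfSurjective hg).symm_apply_apply (Submodule.Quotient.mk m))
  refine ⟨l ∘ₗ f, LinearMap.ext fun x => ?_⟩
  obtain ⟨m, hm⟩ := hg (f x)
  calc g (l (f x)) = a • f x := by rw [← hm, hl, map_smul]
    _ = f x := by rw [← map_smul, haX]

variable [IsArtinianRing A] [Module.Finite A M] [IsSimpleModule A X]

lemma exists_injective_of_annihilator_le
    (h : Module.annihilator A M ≤ Module.annihilator A X) :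
    ∃ f : X →ₗ[A] M, Function.Injective f := by
  obtain ⟨I, hI, ⟨e⟩⟩ := isSimpleModule_iff_quot_maximal.mp ‹IsSimpleModule A X›
  rw [e.annihilator_eq, Ideal.annihilator_quotient] at h
  -- primes of an Artinian ring are maximal, so `I` is minimal over the annihilator of `M`
  have hmin : I ∈ (Module.annihilator A M).minimalPrimes :=
    ⟨⟨hI.isPrime, h⟩, fun J ⟨hJ, _⟩ hJI =>
      ((IsArtinianRing.isMaximal_of_isPrime J).eq_of_le hI.ne_top hJI).ge⟩
  obtain ⟨-, f, hf⟩ := (isAssociatedPrime_iff_exists_injective_linearMap I M).mp <|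
    Module.associatedPrimes.minimalPrimes_annihilator_subset_associatedPrimes A M hmin
  exact ⟨f ∘ₗ e.toLinearMap, hf.comp e.injective⟩

lemma exists_smul_eq_zero_and_smul_eq_self (h : ¬ IsCompositionFactor A M X) :
    ∃ a : A, (∀ m : M, a • m = 0) ∧ ∀ x : X, a • x = x := by
  have hle : ¬ Module.annihilator A M ≤ Module.annihilator A X := fun hle =>
    let ⟨_, hf⟩ := exists_injective_of_annihilator_le hle
    h (isCompositionFactor_of_injective hf)
  obtain ⟨a, haM, haX⟩ := SetLike.not_le_iff_exists.mp hle
  obtain ⟨b, c, hc, hbc⟩ :=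
    (IsSimpleModule.annihilator_isMaximal (R := A) (M := X)).exists_inv haX
  refine ⟨b * a, fun m => ?_, fun x => ?_⟩
  · rw [mul_smul, Module.mem_annihilator.mp haM, smul_zero]
  · simpa only [add_smul, Module.mem_annihilator.mp hc, add_zero, one_smul] using
      congrArg (· • x) hbc

end Commutative

section Multiplicity

lemma last_eq_zero_add_sum {α : Type*} [AddCommMonoid α] {n : ℕ} (a : Fin (n + 1) → α)
    (d : Fin n → α) (h : ∀ i : Fin n, a i.succ = a i.castSucc + d i) :
    a (Fin.last n) = a 0 + ∑ i, d i := by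
  induction n with
  | zero => simp only [Finset.univ_eq_empty, Finset.sum_empty, add_zero]; rfl
  | succ n ih =>
    rw [Fin.sum_univ_castSucc, ← add_assoc, ← Fin.succ_last, h]
    exact congrArg (· + _) (ih (fun i => a i.castSucc) _ fun i => h i.castSucc)

variable (k : Type*) [Field k] {A : Type*} [Ring A] [Algebra k A]
  {M : Type*} [AddCommGroup M] [Module A M]
  {Z : Type*} [AddCommGroup Z] [Module A Z] [Module k Z] [IsScalarTower k A Z]

open Classical in
lemma finrank_linearMap_of_isSimpleModule [IsSimpleModule A M] [IsSimpleModule A Z] :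
    Module.finrank k (M →ₗ[A] Z) =
      if Nonempty (M ≃ₗ[A] Z) then Module.finrank k (Module.End A Z) else 0 := by
  split_ifs with h
  · obtain ⟨e⟩ := h
    exact (LinearEquiv.congrLeft Z k e).finrank_eq
  · have : Subsingleton (M →ₗ[A] Z) := subsingleton_of_forall_eq 0 fun f =>
      f.bijective_or_eq_zero.resolve_left fun hf => h ⟨LinearEquiv.ofBijective f hf⟩
    exact Module.finrank_zero_of_subsingleton

variable [Module k M] [IsScalarTower k A M] [FiniteDimensional k M] [FiniteDimensional k Z]

lemma finrank_linearMap_eq_add [IsSemisimpleModule A M] (N : Submodule A M) :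
    Module.finrank k (M →ₗ[A] Z) =
      Module.finrank k (N →ₗ[A] Z) + Module.finrank k ((M ⧸ N) →ₗ[A] Z) := by
  obtain ⟨C, hC⟩ := exists_isCompl N
  rw [← (LinearEquiv.congrLeft Z k (Submodule.prodEquivOfIsCompl N C hC)).finrank_eq,
    ← (LinearMap.coprodEquiv k).finrank_eq, Module.finrank_prod,
    (LinearEquiv.congrLeft Z k (Submodule.quotientEquivOfIsCompl N C hC)).finrank_eq]

variable [IsSimpleModule A Z]

open Classical in
lemma finrank_linearMap_of_covBy [IsSemisimpleModule A M] {N₁ N₂ : Submodule A M} (h : N₁ ⋖ N₂) :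
    Module.finrank k (N₂ →ₗ[A] Z) = Module.finrank k (N₁ →ₗ[A] Z) +
      if Nonempty ((N₂ ⧸ N₁.submoduleOf N₂) ≃ₗ[A] Z) then Module.finrank k (Module.End A Z)
      else 0 := by
  have : IsSimpleModule A (N₂ ⧸ N₁.submoduleOf N₂) := (covBy_iff_quot_is_simple h.le).mp h
  have : FiniteDimensional k N₂ :=
    .of_injective (N₂.subtype.restrictScalars k) N₂.subtype_injective
  rw [finrank_linearMap_eq_add k (N₁.submoduleOf N₂),
    finrank_linearMap_of_isSimpleModule k (M := N₂ ⧸ N₁.submoduleOf N₂),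
    (LinearEquiv.congrLeft Z k (Submodule.submoduleOfEquivOfLe h.le)).finrank_eq]

theorem finrank_linearMap_eq_compositionMultiplicity_mul [IsSemisimpleModule A M] :
    Module.finrank k (M →ₗ[A] Z) =
      compositionMultiplicity A M Z * Module.finrank k (Module.End A Z) := by
  classical
  have : IsNoetherian A M := isNoetherian_of_tower k inferInstance
  have : IsArtinian A M := isArtinian_of_tower k inferInstance
  have h : ∃ s : CompositionSeries (Submodule A M), s.head = ⊥ ∧ s.last = ⊤ :=
    isFiniteLength_iff_exists_compositionSeries.mp
      (isFiniteLength_iff_isNoetherian_isArtinian.mpr ⟨‹_›, ‹_›⟩)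
  rw [compositionMultiplicity, dif_pos h]
  obtain ⟨hbot, htop⟩ := h.choose_spec
  generalize h.choose = s at *
  have hhead : Module.finrank k (s 0 →ₗ[A] Z) = 0 := by
    have : Subsingleton (s 0) := (Submodule.subsingleton_iff_eq_bot).mpr hbot
    exact Module.finrank_zero_of_subsingleton
  rw [← (LinearEquiv.congrLeft Z k (LinearEquiv.ofTop _ htop)).finrank_eq, RelSeries.last,
    last_eq_zero_add_sum (fun i => Module.finrank k (s i →ₗ[A] Z)) _
      fun i => finrank_linearMap_of_covBy k (s.step i), hhead, zero_add,
    Finset.sum_ite, Finset.sum_const_zero, add_zero, Finset.sum_const, smul_eq_mul,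
    Nat.card_eq_fintype_card, Fintype.card_subtype]

theorem finrank_linearMap_eq_compositionMultiplicity_moduleHead_mul :
    Module.finrank k (M →ₗ[A] Z) =
      compositionMultiplicity A (ModuleHead A M) Z * Module.finrank k (Module.End A Z) := by
  have : IsArtinian A M := isArtinian_of_tower k inferInstance
  have : IsSemisimpleModule A (ModuleHead A M) :=
    (IsArtinian.isSemisimpleModule_iff_jacobson A _).mpr (Module.jacobson_quotient_jacobson A M)
  rw [← finrank_linearMap_eq_compositionMultiplicity_mul k]
  let φ : (ModuleHead A M →ₗ[A] Z) →ₗ[k] (M →ₗ[A] Z) :=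
    LinearMap.lcomp k Z (Module.jacobson A M).mkQ
  have hφ : Function.Surjective φ := fun f => by
    have hf : Module.jacobson A M ≤ LinearMap.ker f := by
      rw [LinearMap.ker, ← IsSemisimpleModule.jacobson_eq_bot A Z]
      exact Module.le_comap_jacobson f
    exact ⟨(Module.jacobson A M).liftQ f hf, Submodule.liftQ_mkQ _ f hf⟩
  exact (LinearEquiv.ofBijective φ ⟨fun _ _ h => Submodule.linearMap_qext _ h, hφ⟩).finrank_eq.symm

end Multiplicity

section ShortExact

open CategoryTheory

variable {A : Type w} [Ring A] {R Y Z : Type w} [AddCommGroup R] [Module A R]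
  [AddCommGroup Y] [Module A Y] [AddCommGroup Z] [Module A Z]

/-- The short complex `ker π → R → Y`. -/
abbrev kerShortComplex (π : R →ₗ[A] Y) : ShortComplex (ModuleCat.{w} A) :=
  ShortComplex.mk (ModuleCat.ofHom (LinearMap.ker π).subtype) (ModuleCat.ofHom π) <| by
    ext x
    exact x.2

lemma kerShortComplex_shortExact {π : R →ₗ[A] Y} (hπ : Function.Surjective π) :
    (kerShortComplex π).ShortExact where
  exact := by
    rw [ShortComplex.moduleCat_exact_iff]
    exact fun x hx => ⟨⟨x, hx⟩, rfl⟩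
  mono_f := (ModuleCat.mono_iff_injective _).mpr (Submodule.subtype_injective _)
  epi_g := (ModuleCat.epi_iff_surjective _).mpr hπ

lemma exists_extend_of_forall_exact_split
    (h : ∀ (E : Type w) [AddCommGroup E] [Module A E] (i : Z →ₗ[A] E) (π : E →ₗ[A] R),
      Function.Injective i → Function.Exact i π → Function.Surjective π →
        ∃ s : R →ₗ[A] E, π ∘ₗ s = LinearMap.id)
    {P : Type w} [AddCommGroup P] [Module A P] {q : P →ₗ[A] R} (hq : Function.Surjective q)
    (f : LinearMap.ker q →ₗ[A] Z) : ∃ f' : P →ₗ[A] Z, f' ∘ₗ (LinearMap.ker q).subtype = f := by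
  -- the pushout of the extension `ker q → P → R` along `f`
  let K : Submodule A (P × Z) := LinearMap.range ((LinearMap.ker q).subtype.prod (-f))
  let i : Z →ₗ[A] (P × Z) ⧸ K := K.mkQ ∘ₗ LinearMap.inr A P Z
  have hK : K ≤ LinearMap.ker (q ∘ₗ LinearMap.fst A P Z) := by
    rintro _ ⟨x, rfl⟩
    exact x.2
  let π : ((P × Z) ⧸ K) →ₗ[A] R := K.liftQ (q ∘ₗ LinearMap.fst A P Z) hK
  have hi : Function.Injective i := (injective_iff_map_eq_zero i).mpr fun z hz => by
    obtain ⟨x, hx⟩ := (Submodule.Quotient.mk_eq_zero K).mp hz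
    obtain ⟨hx₁, hx₂⟩ := Prod.ext_iff.mp hx
    rw [show x = 0 from Subtype.ext hx₁, map_zero] at hx₂
    exact hx₂.symm
  have hiπ : Function.Exact i π := fun e => by
    obtain ⟨⟨x, z⟩, rfl⟩ := K.mkQ_surjective e
    constructor
    · intro hx
      have hz : i (z + f ⟨x, hx⟩) = K.mkQ (x, z) :=
        (Submodule.Quotient.eq K).mpr ⟨-(⟨x, hx⟩ : LinearMap.ker q), by ext <;> simp⟩
      exact ⟨_, hz⟩
    · rintro ⟨z', hz'⟩
      rw [← hz']
      exact map_zero q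
  have hπ : Function.Surjective π := fun y =>
    let ⟨x, hx⟩ := hq y
    ⟨K.mkQ (x, 0), hx⟩
  obtain ⟨r, hr⟩ := ((hiπ.split_tfae hi hπ).out 0 1).mp (h _ i π hi hiπ hπ)
  refine ⟨r ∘ₗ K.mkQ ∘ₗ LinearMap.inl A P Z, LinearMap.ext fun x => ?_⟩
  have hx : K.mkQ (x, 0) = i (f x) := (Submodule.Quotient.eq K).mpr ⟨x, by ext <;> simp⟩
  exact (congrArg r hx).trans (LinearMap.congr_fun hr (f x))

theorem subsingleton_ext_one_of_forall_exact_split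
    (h : ∀ (E : Type w) [AddCommGroup E] [Module A E] (i : Z →ₗ[A] E) (π : E →ₗ[A] R),
      Function.Injective i → Function.Exact i π → Function.Surjective π →
        ∃ s : R →ₗ[A] E, π ∘ₗ s = LinearMap.id) :
    Subsingleton (Abelian.Ext (ModuleCat.of A R) (ModuleCat.of A Z) 1) := by
  refine subsingleton_of_forall_eq 0 fun x => ?_
  let q := Projective.π (ModuleCat.of A R)
  have hq : Function.Surjective q.hom := (ModuleCat.epi_iff_surjective q).mp inferInstance
  have hS := kerShortComplex_shortExact hq
  have : Projective (kerShortComplex q.hom).X₂ := Projective.projective_over (ModuleCat.of A R)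
  obtain ⟨x₁, hx₁⟩ := Abelian.Ext.contravariant_sequence_exact₃ hS (ModuleCat.of A Z) x
    (Abelian.Ext.eq_zero_of_projective _) (add_zero 1)
  obtain ⟨f, rfl⟩ := (Abelian.Ext.mk₀_bijective _ _).2 x₁
  obtain ⟨f', hf'⟩ := exists_extend_of_forall_exact_split h hq f.hom
  have hf : f = (kerShortComplex q.hom).f ≫ ModuleCat.ofHom f' := ModuleCat.hom_ext hf'.symm
  rw [← hx₁, hf, ← Abelian.Ext.mk₀_comp_mk₀, hS.extClass_comp_assoc]

variable (k : Type*) [Field k] [Algebra k A] [Module k Z] [IsScalarTower k A Z]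

lemma hom_eq_smul {M N : ModuleCat.{w} A} {c : k} {f g : M ⟶ N}
    (h : ∀ x, g x = algebraMap k A c • f x) : g = c • f := by
  ext x
  exact h x

/-- The connecting map `Hom(ker π, Z) → Ext¹(Y, Z)` of the short exact sequence
`0 → ker π → R → Y → 0`. -/
def connectingMap {π : R →ₗ[A] Y} (hπ : Function.Surjective π) :
    (LinearMap.ker π →ₗ[A] Z) →ₗ[k] Abelian.Ext (ModuleCat.of A Y) (ModuleCat.of A Z) 1 where
  toFun f :=
    (kerShortComplex_shortExact hπ).extClass.comp (Abelian.Ext.mk₀ (ModuleCat.ofHom f)) (add_zero 1)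
  map_add' f g := by
    rw [ModuleCat.ofHom_add, Abelian.Ext.mk₀_add, Abelian.Ext.comp_add]
  map_smul' c f := by
    have hcf := hom_eq_smul k (f := ModuleCat.ofHom f) (g := ModuleCat.ofHom (c • f))
      fun x => (algebraMap_smul A c (f x)).symm
    rw [hcf, Abelian.Ext.mk₀_smul, Abelian.Ext.comp_smul, RingHom.id_apply]

theorem connectingMap_bijective {π : R →ₗ[A] Y} (hπ : Function.Surjective π)
    (hHom : Subsingleton (R →ₗ[A] Z))
    (hExt : Subsingleton (Abelian.Ext (ModuleCat.of A R) (ModuleCat.of A Z) 1)) :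
    Function.Bijective (connectingMap (Z := Z) k hπ) := by
  have hS := kerShortComplex_shortExact hπ
  refine ⟨(injective_iff_map_eq_zero _).mpr fun f hf => ?_, fun x => ?_⟩
  · obtain ⟨x₂, hx₂⟩ := Abelian.Ext.contravariant_sequence_exact₁ hS _
      (Abelian.Ext.mk₀ (ModuleCat.ofHom f)) (add_zero 1) hf
    obtain ⟨g, rfl⟩ := (Abelian.Ext.mk₀_bijective _ _).2 x₂
    rw [Abelian.Ext.mk₀_comp_mk₀] at hx₂
    have hgf : g.hom ∘ₗ (LinearMap.ker π).subtype = f :=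
      congrArg ModuleCat.Hom.hom ((Abelian.Ext.mk₀_bijective _ _).1 hx₂)
    rw [← hgf, Subsingleton.elim g.hom 0, LinearMap.zero_comp]
  · obtain ⟨x₁, hx₁⟩ := Abelian.Ext.contravariant_sequence_exact₃ hS (ModuleCat.of A Z) x
      (Subsingleton.elim _ _) (add_zero 1)
    obtain ⟨f, rfl⟩ := (Abelian.Ext.mk₀_bijective _ _).2 x₁
    exact ⟨f.hom, hx₁⟩

end ShortExact

section ExtDimension

open CategoryTheory

variable (k : Type*) [Field k] {A : Type w} [Ring A] [Algebra k A] {R Y Z : Type w}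
  [AddCommGroup R] [Module A R] [Module k R] [IsScalarTower k A R] [FiniteDimensional k R]
  [AddCommGroup Y] [Module A Y]
  [AddCommGroup Z] [Module A Z] [Module k Z] [IsScalarTower k A Z] [FiniteDimensional k Z]

theorem finrank_ext_one_eq_compositionMultiplicity_moduleHead_mul [IsSimpleModule A Z]
    (hHom : Subsingleton (R →ₗ[A] Z))
    (hExt : Subsingleton (Abelian.Ext (ModuleCat.of A R) (ModuleCat.of A Z) 1))
    {N : Submodule A R} (e : (R ⧸ N) ≃ₗ[A] Y) :
    FiniteDimensional k (Abelian.Ext (ModuleCat.of A Y) (ModuleCat.of A Z) 1) ∧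
      Module.finrank k (Abelian.Ext (ModuleCat.of A Y) (ModuleCat.of A Z) 1) =
        compositionMultiplicity A (ModuleHead A N) Z * Module.finrank k (Module.End A Z) := by
  have : FiniteDimensional k N := .of_injective (N.subtype.restrictScalars k) N.subtype_injective
  let π : R →ₗ[A] Y := e.toLinearMap ∘ₗ N.mkQ
  have hker : LinearMap.ker π = N := by
    rw [LinearMap.ker_comp_of_ker_eq_bot _ e.ker, Submodule.ker_mkQ]
  let δ := LinearEquiv.congrLeft Z k (LinearEquiv.ofEq _ _ hker.symm) ≪≫ₗ
    LinearEquiv.ofBijective _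
      (connectingMap_bijective k (e.surjective.comp N.mkQ_surjective : Function.Surjective π)
        hHom hExt)
  exact ⟨Module.Finite.equiv δ, by
    rw [← δ.finrank_eq, finrank_linearMap_eq_compositionMultiplicity_moduleHead_mul k]⟩

end ExtDimension

section HarishChandra

/-- Frobenius reciprocity for representations, `Hom_G(Ind_φ ρ, τ) ≃ Hom_H(ρ, Res_φ τ)`, transported
from the adjunction between the categories of representations. -/
def indHomEquiv {k : Type u} [Field k] {G H : Type v} [Group G] [Group H] (φ : H →* G)
    {V W : Type (max u v)} [AddCommGroup V] [Module k V] [AddCommGroup W] [Module k W]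
    (ρ : Representation k H V) (τ : Representation k G W) :
    (ind φ ρ).IntertwiningMap τ ≃ₗ[k] ρ.IntertwiningMap (τ.comp φ : Representation k H W) :=
  (Rep.homLinearEquiv (Rep.of (ind φ ρ)) (Rep.of τ)).symm ≪≫ₗ
    Rep.indResHomEquiv φ (Rep.of ρ) (Rep.of τ) ≪≫ₗ Rep.homLinearEquiv (Rep.of ρ) (Rep.of _)

variable {G : Type v} [Group G] {k : Type u} [Field k] {p : ℕ} {P L : Subgroup G} (hL : L ≤ P)

section Inflation

lemma exists_inclusion_mul_eq (h : Subgroup.IsComplement' (L.subgroupOf P) (pCore p P)) (b : P) :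
    ∃ l : L, ∃ u ∈ pCore p P, Subgroup.inclusion hL l * u = b := by
  obtain ⟨⟨l, u⟩, hb⟩ := h.2 b
  exact ⟨⟨l.1, l.2⟩, u, u.2, hb⟩

variable (h : Subgroup.IsComplement' (L.subgroupOf P) (pCore p P))

lemma leviProj_of_mem_pCore {u : P} (hu : u ∈ pCore p P) : leviProj p P L hL h u = 1 := by
  rw [leviProj, MonoidHom.comp_apply, QuotientGroup.mk'_apply,
    (QuotientGroup.eq_one_iff u).mpr hu, map_one]

lemma leviProj_inclusion (l : L) : leviProj p P L hL h (Subgroup.inclusion hL l) = l := by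
  have : h.QuotientMulEquiv (QuotientGroup.mk' (pCore p P) (Subgroup.inclusion hL l)) =
      (Subgroup.subgroupOfEquivOfLe hL).symm l :=
    (MulEquiv.eq_symm_apply _).mp rfl
  simp only [leviProj, MonoidHom.comp_apply, MulEquiv.coe_toMonoidHom, this,
    MulEquiv.apply_symm_apply]

variable {V W : Type*} [AddCommGroup V] [Module k V] [AddCommGroup W] [Module k W]
  (X : Representation k L V) (τ : Representation k G W)

/-- The inflation of a representation of `L` along the projection `P = O_p(P) ⋊ L → L`. -/
abbrev inflation : Representation k P V :=
  X.comp (leviProj p P L hL h)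

lemma inflation_inclusion (l : L) : inflation hL h X (Subgroup.inclusion hL l) = X l :=
  congrArg X (leviProj_inclusion hL h l)

lemma inflation_of_mem_pCore {u : P} (hu : u ∈ pCore p P) : inflation hL h X u = 1 :=
  (congrArg X (leviProj_of_mem_pCore hL h hu)).trans (map_one X)

/-- Inflation is left adjoint to taking the fixed points of `O_p(P)`. -/
def inflationHomEquiv :
    (inflation hL h X).IntertwiningMap (τ.comp P.subtype : Representation k P W) ≃ₗ[k]
      X.IntertwiningMap (hcRes p P L hL τ) where
  toFun f :=
    { toLinearMap := f.toLinearMap.codRestrict (hcFixed p P τ) fun x u => by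
        have := f.isIntertwining _ _ u x
        rwa [inflation_of_mem_pCore hL h X u.2, Module.End.one_apply, eq_comm] at this
      isIntertwining' l := by
        ext x
        have := f.isIntertwining _ _ (Subgroup.inclusion hL l) x
        rwa [inflation_inclusion] at this }
  map_add' _ _ := rfl
  map_smul' _ _ := rfl
  invFun f :=
    { toLinearMap := (hcFixed p P τ).subtype ∘ₗ f.toLinearMap
      isIntertwining' b := by
        obtain ⟨l, u, hu, rfl⟩ := exists_inclusion_mul_eq hL h b
        ext x
        have hl : (f (X l x) : W) = τ l (f x) := congrArg Subtype.val (f.isIntertwining _ _ l x)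
        have hu' : τ u (f x) = f x := (f x).2 ⟨u, hu⟩
        rw [map_mul, map_mul, inflation_inclusion, inflation_of_mem_pCore hL h X hu, mul_one]
        exact hl.trans (congrArg (τ l) hu'.symm) }
  left_inv _ := rfl
  right_inv _ := rfl

end Inflation

section Exactness

variable {U V W : Type*} [AddCommGroup U] [Module k U] [AddCommGroup V] [Module k V]
  [AddCommGroup W] [Module k W] {ρ : Representation k G U} {σ : Representation k G V}
  {τ : Representation k G W}

/-- The action of Harish-Chandra restriction on homomorphisms. -/
def hcResMap (f : σ.IntertwiningMap τ) :
    (hcRes p P L hL σ).IntertwiningMap (hcRes p P L hL τ) where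
  toLinearMap := f.toLinearMap.restrict fun _ hv u =>
    (f.isIntertwining _ _ _ _).symm.trans (congrArg f (hv u))
  isIntertwining' _ := by
    ext v
    exact f.isIntertwining _ _ _ v.1

lemma hcResMap_exact {i : ρ.IntertwiningMap σ} {f : σ.IntertwiningMap τ}
    (hi : Function.Injective i) (h : Function.Exact i f) :
    Function.Exact (hcResMap (p := p) hL i) (hcResMap (p := p) hL f) := by
  rintro ⟨v, hv⟩
  constructor
  · intro h0
    obtain ⟨u, rfl⟩ := (h v).mp (congrArg Subtype.val h0)
    exact ⟨⟨u, fun c => hi ((i.isIntertwining _ _ _ _).trans (hv c))⟩, rfl⟩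
  · rintro ⟨u, hu⟩
    exact Subtype.ext ((h v).mpr ⟨u, congrArg Subtype.val hu⟩)

lemma exists_mem_invariants_of_surjective {H : Type*} [Group H] [Finite H]
    (hH : (Nat.card H : k) ≠ 0) {σ : Representation k H V} {τ : Representation k H W}
    {f : σ.IntertwiningMap τ} (hf : Function.Surjective f) {w : W} (hw : w ∈ τ.invariants) :
    ∃ v ∈ σ.invariants, f v = w := by
  have := Fintype.ofFinite H
  rw [Nat.card_eq_fintype_card] at hH
  have := invertibleOfNonzero hH
  obtain ⟨v, rfl⟩ := hf w
  refine ⟨σ.averageMap v, σ.averageMap_invariant v, ?_⟩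
  calc f (σ.averageMap v) = τ.averageMap (f v) :=
        (IntertwiningMap.equivLinearMapAsModule σ τ f).map_smul (GroupAlgebra.average k H) v
    _ = f v := τ.averageMap_id _ hw

lemma hcResMap_surjective [Finite P] (hp : (Nat.card (pCore p P) : k) ≠ 0)
    {f : σ.IntertwiningMap τ} (hf : Function.Surjective f) :
    Function.Surjective (hcResMap (p := p) hL f) := by
  rintro ⟨w, hw⟩
  let f' : IntertwiningMap ((σ.comp P.subtype).comp (pCore p P).subtype : Representation k _ V)
      ((τ.comp P.subtype).comp (pCore p P).subtype : Representation k _ W) :=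
    ⟨f.toLinearMap, fun u => f.isIntertwining' u⟩
  obtain ⟨v, hv, hvw⟩ := exists_mem_invariants_of_surjective hp (f := f') hf hw
  exact ⟨⟨v, hv⟩, Subtype.ext hvw⟩

end Exactness

section Adjunction

variable (h : Subgroup.IsComplement' (L.subgroupOf P) (pCore p P))
  {VX VE VZ : Type (max u v)} [AddCommGroup VX] [Module k VX] [AddCommGroup VE] [Module k VE]
  [AddCommGroup VZ] [Module k VZ] (X : Representation k L VX)

/-- Harish-Chandra induction is left adjoint to Harish-Chandra restriction. -/
def hcIndHomEquiv (Z : Representation k G VZ) :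
    (hcInd p P L hL h X).IntertwiningMap Z ≃ₗ[k] X.IntertwiningMap (hcRes p P L hL Z) :=
  indHomEquiv P.subtype _ Z ≪≫ₗ inflationHomEquiv hL h X Z

lemma hcIndHomEquiv_comp {E : Representation k G VE} {Z : Representation k G VZ}
    (g : E.IntertwiningMap Z) (f : (hcInd p P L hL h X).IntertwiningMap E) :
    hcIndHomEquiv hL h X Z (g.comp f) = (hcResMap hL g).comp (hcIndHomEquiv hL h X E f) := rfl

variable {X}

lemma hcInd_intertwiningMap_eq_zero [X.IsIrreducible] {Z : Representation k G VZ}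
    (hXZ : ¬ IsCompositionFactor k[L] (hcRes p P L hL Z).asModule X.asModule)
    (f : (hcInd p P L hL h X).IntertwiningMap Z) : f = 0 := by
  let g := hcIndHomEquiv hL h X Z f
  have hg : g = 0 := (IsIrreducible.injective_or_eq_zero g).resolve_left fun hinj =>
    hXZ (isCompositionFactor_of_injective (f := IntertwiningMap.equivLinearMapAsModule _ _ g) hinj)
  exact (hcIndHomEquiv hL h X Z).map_eq_zero_iff.mp hg

open scoped IsMulCommutative

variable [IsMulCommutative L] [X.IsIrreducible]

lemma exists_surjective_hcInd [Finite L] {Y : Representation k G VZ} [Y.IsIrreducible]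
    [FiniteDimensional k VZ]
    (hXY : IsCompositionFactor k[L] (hcRes p P L hL Y).asModule X.asModule) :
    ∃ f : (hcInd p P L hL h X).IntertwiningMap Y, Function.Surjective f := by
  have : IsArtinianRing k[L] := IsArtinianRing.of_finite k _
  have : Module.Finite k[L] (hcRes p P L hL Y).asModule :=
    Module.Finite.of_restrictScalars_finite k _ _
  obtain ⟨f, hf⟩ := exists_injective_of_annihilator_le hXY.annihilator_le
  let g := (hcIndHomEquiv hL h X Y).symm ((IntertwiningMap.equivLinearMapAsModule _ _).symm f)
  have hg : g ≠ 0 := by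
    simp only [g, ne_eq, LinearEquiv.map_eq_zero_iff]
    rintro rfl
    have : Nontrivial X.asModule := IsSimpleModule.nontrivial k[L] _
    obtain ⟨x, hx⟩ := exists_ne (0 : X.asModule)
    exact hx (hf rfl)
  exact ⟨g, (IsIrreducible.surjective_or_eq_zero g).resolve_right hg⟩

theorem exists_section_hcInd [Finite P] (hp : (Nat.card (pCore p P) : k) ≠ 0)
    {Z : Representation k G VZ} [FiniteDimensional k VZ]
    (hXZ : ¬ IsCompositionFactor k[L] (hcRes p P L hL Z).asModule X.asModule)
    {E : Representation k G VE} {i : Z.IntertwiningMap E}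
    {π : E.IntertwiningMap (hcInd p P L hL h X)} (hi : Function.Injective i)
    (hiπ : Function.Exact i π) (hπ : Function.Surjective π) :
    ∃ s : (hcInd p P L hL h X).IntertwiningMap E, π.comp s = IntertwiningMap.id _ := by
  have : Finite L := Finite.of_injective _ (Subgroup.inclusion_injective hL)
  have : IsArtinianRing k[L] := IsArtinianRing.of_finite k _
  have : Module.Finite k[L] (hcRes p P L hL Z).asModule :=
    Module.Finite.of_restrictScalars_finite k _ _
  obtain ⟨a, haZ, haX⟩ := exists_smul_eq_zero_and_smul_eq_self hXZ
  obtain ⟨t, ht⟩ := exists_lift_of_smul_eq_zero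
    (i := IntertwiningMap.equivLinearMapAsModule _ _ (hcResMap hL i))
    (g := IntertwiningMap.equivLinearMapAsModule _ _ (hcResMap hL π))
    (hcResMap_exact hL hi hiπ) (hcResMap_surjective hL hp hπ) haZ haX
    (IntertwiningMap.equivLinearMapAsModule _ _
      (hcIndHomEquiv hL h X _ (IntertwiningMap.id _)))
  refine ⟨(hcIndHomEquiv hL h X _).symm ((IntertwiningMap.equivLinearMapAsModule _ _).symm t),
    (hcIndHomEquiv hL h X _).injective ?_⟩
  rw [hcIndHomEquiv_comp, LinearEquiv.apply_symm_apply]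
  exact (IntertwiningMap.equivLinearMapAsModule _ _).injective ht

end Adjunction

end HarishChandra

section AsModule

/-- The representation on a `kG`-module, regarded as a `kG`-module again. -/
def ofModuleAsModuleEquiv (k G M : Type*) [Field k] [Group G] [AddCommGroup M] [Module k M]
    [Module k[G] M] [IsScalarTower k k[G] M] :
    (ofModule' M : Representation k G M).asModule ≃ₗ[k[G]] M where
  __ := (ofModule' M : Representation k G M).asModuleEquiv.toAddEquiv
  map_smul' a m := congrArg (fun f : k[G] →ₐ[k] Module.End k M => f a m)
    ((MonoidAlgebra.lift k (Module.End k M) G).apply_symm_apply (Algebra.lsmul k k M))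

variable {G : Type v} [Group G] {k : Type u} [Field k] {p : ℕ} {P L : Subgroup G}
  (hL : L ≤ P) (h : Subgroup.IsComplement' (L.subgroupOf P) (pCore p P))
  {VX VZ : Type (max u v)} [AddCommGroup VX] [Module k VX]
  [AddCommGroup VZ] [Module k VZ] {X : Representation k L VX} [X.IsIrreducible]
  [IsMulCommutative L]

lemma exists_section_hcInd_asModule [Finite P] (hp : (Nat.card (pCore p P) : k) ≠ 0)
    {Z : Representation k G VZ} [FiniteDimensional k VZ]
    (hXZ : ¬ IsCompositionFactor k[L] (hcRes p P L hL Z).asModule X.asModule)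
    {E : Type (max u v)} [AddCommGroup E] [Module k[G] E] {i : Z.asModule →ₗ[k[G]] E}
    {π : E →ₗ[k[G]] (hcInd p P L hL h X).asModule} (hi : Function.Injective i)
    (hiπ : Function.Exact i π) (hπ : Function.Surjective π) :
    ∃ s : (hcInd p P L hL h X).asModule →ₗ[k[G]] E, π ∘ₗ s = LinearMap.id := by
  let _ : Module k E := Module.restrictScalars k k[G] E
  have : IsScalarTower k k[G] E := IsScalarTower.restrictScalars k k[G] E
  let ε := ofModuleAsModuleEquiv k G E
  obtain ⟨s, hs⟩ := exists_section_hcInd hL h hp hXZ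
    (i := (IntertwiningMap.equivLinearMapAsModule _ _).symm (ε.symm.toLinearMap ∘ₗ i))
    (π := (IntertwiningMap.equivLinearMapAsModule _ _).symm (π ∘ₗ ε.toLinearMap))
    hi hiπ hπ
  exact ⟨ε.toLinearMap ∘ₗ IntertwiningMap.equivLinearMapAsModule _ _ s,
    (IntertwiningMap.equivLinearMapAsModule _ _).symm.injective hs⟩

end AsModule

section FiniteGroups

variable {G k : Type*} [Group G] [Field k]

lemma finiteDimensional_of_isIrreducible [Finite G] {V : Type*} [AddCommGroup V] [Module k V]
    (ρ : Representation k G V) [ρ.IsIrreducible] : FiniteDimensional k V :=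
  (Module.Finite.trans k[G] ρ.asModule : FiniteDimensional k ρ.asModule)

lemma isIrreducible_of_finrank_eq_one {V : Type*} [AddCommGroup V] [Module k V]
    (ρ : Representation k G V) (h : Module.finrank k V = 1) : ρ.IsIrreducible :=
  (irreducible_iff_isSimpleModule_asModule ρ).mpr <| (isSimpleModule_iff _ _).mpr <|
    is_simple_module_of_finrank_eq_one (K := k) (V := ρ.asModule) h

lemma natCast_card_pCore_ne_zero {p r : ℕ} (hp : p.Prime) (hr : r.Prime) (hpr : r ≠ p)
    (P : Type*) [Group P] [Finite P] (k : Type*) [Field k] [CharP k r] :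
    (Nat.card (pCore p P) : k) ≠ 0 := by
  have := Fact.mk hp
  have hP : IsPGroup p (pCore p P) := Sylow.sSup_of_normal _ (fun _ hK => hK.2) fun _ hK => hK.1
  obtain ⟨n, hn⟩ := IsPGroup.iff_card.mp hP
  rw [hn, Ne, CharP.cast_eq_zero_iff k r]
  exact fun h => hpr ((Nat.prime_dvd_prime_iff_eq hr hp).mp (hr.dvd_of_dvd_pow h))

end FiniteGroups

namespace SplitBNPair

variable {p : ℕ} {G : Type v} [Group G] (D : SplitBNPair p G)

lemma isMulCommutative_T : IsMulCommutative D.T :=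
  ⟨⟨fun s t => Subtype.ext (D.torus_comm s s.2 t t.2)⟩⟩

lemma conj_mem_T {n t : G} (hn : n ∈ D.N) (ht : t ∈ D.T) : n * t * n⁻¹ ∈ D.T :=
  D.torus_normal.conj_mem ⟨t, ht.2⟩ ht ⟨n, hn⟩

lemma T_le_of_isLeviPair {P L : Subgroup G} (h : D.IsLeviPair P L) : D.T ≤ L := by
  obtain ⟨J, -, n₀, ⟨-, hB⟩, n, hn, -, rfl⟩ := h
  intro t ht
  have ht' : n⁻¹ * t * n ∈ D.T := by
    simpa only [inv_inv] using D.conj_mem_T (D.N.inv_mem hn) ht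
  have ht'' : n⁻¹ * t * n ∈ conjSubgroup n₀ D.B := (hB.ge ht').2
  exact ⟨n⁻¹ * t * n, ⟨Subgroup.mem_sup_left ht'.1, Subgroup.mem_sup_left ht''⟩,
    by simp [mul_assoc]⟩

variable {k : Type u} [Field k]

lemma inPrincipalSeries_iff_isCompositionFactor {VX VZ : Type*} [AddCommGroup VX] [Module k VX]
    (X : Representation k D.T VX) [AddCommGroup VZ] [Module k VZ] (Z : Representation k G VZ)
    [Z.IsIrreducible] :
    D.InPrincipalSeries X Z ↔
      IsCompositionFactor k[D.T] (hcRes p D.B D.T D.T_le_B Z).asModule X.asModule :=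
  ⟨fun h => h.2.2.2, fun h => ⟨‹_›, (Submodule.nontrivial_iff_ne_bot).mp h.nontrivial,
    fun _ _ hPL hlt => absurd (D.T_le_of_isLeviPair hPL) hlt.not_ge, h⟩⟩

end SplitBNPair

section InducedExtensions

variable {G : Type v} [Group G] {k : Type u} [Field k] {p : ℕ} {P L : Subgroup G}
  (hL : L ≤ P) (h : Subgroup.IsComplement' (L.subgroupOf P) (pCore p P))

lemma finiteDimensional_hcInd [Finite G] {V : Type*} [AddCommGroup V] [Module k V]
    [FiniteDimensional k V] (X : Representation k L V) :
    FiniteDimensional k (hcInd p P L hL h X).asModule :=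
  inferInstanceAs <| FiniteDimensional k (Coinvariants (tprod
    ((leftRegular k G).comp P.subtype) (X.comp (leviProj p P L hL h))))

variable {VX VY VZ : Type (max u v)} [AddCommGroup VX] [Module k VX] [AddCommGroup VY]
  [Module k VY] [AddCommGroup VZ] [Module k VZ] {X : Representation k L VX} [X.IsIrreducible]
  {Z : Representation k G VZ}

theorem subsingleton_extOne_hcInd [Finite P] [IsMulCommutative L]
    (hp : (Nat.card (pCore p P) : k) ≠ 0) [FiniteDimensional k VZ]
    (hXZ : ¬ IsCompositionFactor k[L] (hcRes p P L hL Z).asModule X.asModule) :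
    Subsingleton (ExtOne k G (hcInd p P L hL h X).asModule Z.asModule) :=
  subsingleton_ext_one_of_forall_exact_split fun _ _ _ _ _ hi hiπ hπ =>
    exists_section_hcInd_asModule hL h hp hXZ hi hiπ hπ

lemma subsingleton_hcInd_linearMap
    (hXZ : ¬ IsCompositionFactor k[L] (hcRes p P L hL Z).asModule X.asModule) :
    Subsingleton ((hcInd p P L hL h X).asModule →ₗ[k[G]] Z.asModule) :=
  subsingleton_of_forall_eq 0 fun _ =>
    (IntertwiningMap.equivLinearMapAsModule _ _).symm.map_eq_zero_iff.mp <|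
      hcInd_intertwiningMap_eq_zero hL h hXZ _

theorem theorem4p1_general [Finite G] [IsMulCommutative L]
    (hp : (Nat.card (pCore p P) : k) ≠ 0) (Y : Representation k G VY) [Y.IsIrreducible]
    (hXY : IsCompositionFactor k[L] (hcRes p P L hL Y).asModule X.asModule)
    (Z : Representation k G VZ) [Z.IsIrreducible]
    (hXZ : ¬ IsCompositionFactor k[L] (hcRes p P L hL Z).asModule X.asModule) :
    Subsingleton (ExtOne k G (hcInd p P L hL h X).asModule Z.asModule) ∧
    (∃ L₀ : Submodule k[G] (hcInd p P L hL h X).asModule,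
      Nonempty (((hcInd p P L hL h X).asModule ⧸ L₀) ≃ₗ[k[G]] Y.asModule)) ∧
    ∀ L₀ : Submodule k[G] (hcInd p P L hL h X).asModule,
      Nonempty (((hcInd p P L hL h X).asModule ⧸ L₀) ≃ₗ[k[G]] Y.asModule) →
      FiniteDimensional k (ExtOne k G Y.asModule Z.asModule) ∧
      Module.finrank k (ExtOne k G Y.asModule Z.asModule) =
        compositionMultiplicity k[G] (ModuleHead k[G] L₀) Z.asModule *
          Module.finrank k (Module.End k[G] Z.asModule) := by
  have := finiteDimensional_of_isIrreducible X
  have := finiteDimensional_of_isIrreducible Y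
  have := finiteDimensional_of_isIrreducible Z
  have := finiteDimensional_hcInd hL h X
  have hExt := subsingleton_extOne_hcInd hL h hp hXZ
  refine ⟨hExt, ?_, fun L₀ ⟨e⟩ => ?_⟩
  · obtain ⟨f, hf⟩ := exists_surjective_hcInd hL h hXY
    exact ⟨_, ⟨(IntertwiningMap.equivLinearMapAsModule _ _ f).quotKerEquivOfSurjective hf⟩⟩
  · exact finrank_ext_one_eq_compositionMultiplicity_moduleHead_mul k
      (Z := Z.asModule) (subsingleton_hcInd_linearMap hL h hXZ) hExt e

end InducedExtensions

end

theorem theorem4p1 {p r : ℕ} (hp : p.Prime) (hr : r.Prime) (hpr : r ≠ p)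
    {G : Type v} [Group G] [Finite G] (D : SplitBNPair p G)
    {k : Type u} [Field k] [IsAlgClosed k] [CharP k r]
    {VX : Type (max u v)} [AddCommGroup VX] [Module k VX] (X : Representation k D.T VX)
    (hX : Module.finrank k VX = 1)
    {VY : Type (max u v)} [AddCommGroup VY] [Module k VY] [FiniteDimensional k VY]
    (Y : Representation k G VY) (hY : D.InPrincipalSeries X Y)
    {VZ : Type (max u v)} [AddCommGroup VZ] [Module k VZ] [FiniteDimensional k VZ]
    (Z : Representation k G VZ) (hZ : Z.IsIrreducible) (hZX : ¬ D.InPrincipalSeries X Z) :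
    Subsingleton (ExtOne k G (D.R X) Z.asModule) ∧
    (∃ L₀ : Submodule k[G] (D.R X), Nonempty ((D.R X ⧸ L₀) ≃ₗ[k[G]] Y.asModule)) ∧
    ∀ L₀ : Submodule k[G] (D.R X), Nonempty ((D.R X ⧸ L₀) ≃ₗ[k[G]] Y.asModule) →
      FiniteDimensional k (ExtOne k G Y.asModule Z.asModule) ∧
      Module.finrank k (ExtOne k G Y.asModule Z.asModule) =
        compositionMultiplicity k[G] (ModuleHead k[G] L₀) Z.asModule := by
  have := isIrreducible_of_finrank_eq_one X hX
  have := hY.1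
  have := D.isMulCommutative_T
  have hEnd : Module.finrank k (Module.End k[G] Z.asModule) = 1 :=
    (Representation.IntertwiningMap.equivAlgEnd Z).symm.toLinearEquiv.finrank_eq.trans
      (Representation.IsIrreducible.finrank_intertwiningMap_self Z)
  simpa only [hEnd, mul_one] using theorem4p1_general D.T_le_B D.split
    (natCast_card_pCore_ne_zero hp hr hpr D.B k) Y hY.2.2.2 Z
    (mt (D.inPrincipalSeries_iff_isCompositionFactor X Z).mpr hZX)
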